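/- Fix $\gamma>\tfrac12$. For each $N$ let $M^N$ be an $N\times N$ complex block diagonal matrix whose diagonal blocks are $\ell=\ell(N)$ Jordan blocks $B^1,\dots,B^{\ell}$ (ones on the superdiagonal), where $B^i=B^i(N)$ has eigenvalue $c_i=c_i(N)\in\mathbb{C}$ and dimension $d_i=d_i(N)\ge 1$, with $\sum_{i=1}^{\ell} d_i=N$. Write $d_i=a_i\log N$ and put $r_i=\exp\big((-\gamma+\tfrac12)/a_i\big)$ and $$\mu_N=\sum_{i=1}^{\ell}\frac{d_i}{N}\,m_{c_i,r_i},$$ where $m_{c,r}$ is the uniform probability measure on the circle with center $c$ and radius $r$. Let $G^N$ be an $N\times N$ matrix of i.i.d. standard real normal variables and let $L_N$ be the empirical spectral measure of $M^N+N^{-\gamma}G^N$ (the eigenvalues being counted with algebraic multiplicity). For a compactly supported finite measure $\rho$ on $\mathbb{C}$ let $U_\rho(z)=\int_{\mathbb{C}}\log|z-x|\,d\rho(x)\in[-\infty,\infty)$; thus $U_{L_N}(z)=\frac1N\log\big|\det(M^N+N^{-\gamma}G^N-zI)\big|$. Assume that $\ell(N)=o(N)$. Then for every $z\in\mathbb{C}$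 and every $\delta>0$, $$\Pr\big[\,U_{L_N}(z)\ \ge\ U_{\mu_N}(z)+\delta\,\big]\longrightarrow 0\qquad (N\to\infty).$$ -/

import Mathlib

open MeasureTheory ProbabilityTheory Filter Topology
open scoped ENNReal

noncomputable section

/-- The `d × d` Jordan block with eigenvalue `c` (ones on the first superdiagonal). -/
def jordanBlock (d : ℕ) (c : ℂ) : Matrix (Fin d) (Fin d) ℂ :=
  Matrix.of fun i j => if i = j then c else if (i : ℕ) + 1 = (j : ℕ) then 1 else 0

/-- The data of an `N × N` matrix in Jordan form: the number `ℓ` of blocks, their dimensions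
(positive integers with sum `N`) and their eigenvalues. -/
structure JordanData (N : ℕ) where
  ℓ : ℕ
  dim : Fin ℓ → ℕ
  dim_pos : ∀ i, 0 < dim i
  sum_dim : ∑ i, dim i = N
  eig : Fin ℓ → ℂ

namespace JordanData

variable {N : ℕ} (B : JordanData N)

/-- The positions `0, …, N - 1`, listed block after block. -/
def index : (Σ i : Fin B.ℓ, Fin (B.dim i)) ≃ Fin N :=
  finSigmaFinEquiv.trans (finCongr B.sum_dim)

/-- The `N × N` block diagonal matrix whose diagonal blocks are the Jordan blocks. -/
def matrix : Matrix (Fin N) (Fin N) ℂ :=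
  Matrix.reindex B.index B.index
    (Matrix.blockDiagonal' fun i => jordanBlock (B.dim i) (B.eig i))

/-- The number `a_i` for which the `i`-th block has dimension `a_i log N`. -/
def a (i : Fin B.ℓ) : ℝ := (B.dim i : ℝ) / Real.log N

/-- The radius `r_i = exp ((-γ + 1/2) / a_i)`. -/
def radius (γ : ℝ) (i : Fin B.ℓ) : ℝ := Real.exp ((-γ + 1 / 2) / B.a i)

end JordanData

/-- The uniform probability measure on the circle with center `c` and radius `r`. -/
def uniformCircle (c : ℂ) (r : ℝ) : Measure ℂ :=
  Measure.map (circleMap c r)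
    ((ENNReal.ofReal (2 * Real.pi))⁻¹ • volume.restrict (Set.Ioc 0 (2 * Real.pi)))

/-- The measure `∑ i, (dim i / N) m_{c_i, r_i}`, where `dim i = a_i log N`. -/
def JordanData.circleMeasure {N : ℕ} (B : JordanData N) (γ : ℝ) : Measure ℂ :=
  ∑ i, ((B.dim i : ℝ≥0∞) / (N : ℝ≥0∞)) • uniformCircle (B.eig i) (B.radius γ i)

/-- The empirical spectral measure `(1/N) ∑ δ_{λ_i}`, the eigenvalues being counted with
algebraic multiplicity. -/
def empiricalSpectralMeasure {N : ℕ} (A : Matrix (Fin N) (Fin N) ℂ) : Measure ℂ :=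
  (N : ℝ≥0∞)⁻¹ • (A.charpoly.roots.map fun x => Measure.dirac x).sum

/-- The logarithmic potential `∫ log |z - x| dρ(x)` of a compactly supported finite measure, as
the integral of the positive part minus the integral of the negative part. Here `log 0 = -∞`, and
the value `-∞` is possible (for example at an atom of `ρ`). -/
def logPotential (ρ : Measure ℂ) (z : ℂ) : EReal :=
  ((∫⁻ x, (ENNReal.log ‖z - x‖ₑ).toENNReal ∂ρ : ℝ≥0∞) : EReal) -
    ((∫⁻ x, (-ENNReal.log ‖z - x‖ₑ).toENNReal ∂ρ : ℝ≥0∞) : EReal)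

/-- `G` is a random `N × N` matrix whose entries are i.i.d. standard (real) normal variables. -/
structure IsStdGaussianMatrix {Ω : Type*} [MeasurableSpace Ω] (P : Measure Ω) {N : ℕ}
    (G : Ω → Matrix (Fin N) (Fin N) ℝ) : Prop where
  hasLaw : ∀ i j, HasLaw (fun ω => G ω i j) (gaussianReal 0 1) P
  indep : iIndepFun (fun (p : Fin N × Fin N) ω => G ω p.1 p.2) P

/-- The noisy matrix `M + N^{-γ} G`. -/
def JordanData.noisy {N : ℕ} (B : JordanData N) (γ : ℝ) (G : Matrix (Fin N) (Fin N) ℝ) :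
    Matrix (Fin N) (Fin N) ℂ :=
  B.matrix + (((N : ℝ) ^ (-γ) : ℝ) : ℂ) • G.map Complex.ofReal

end

/-!
The determinant of `M - z + N^{-γ} G` is controlled in mean square. If `v` is a random vector, then
`det (H + v vᴴ)` is affine in `v vᴴ`, and `det (H + P) ≥ det H (1 + tr (H⁻¹ P))` for `P ≥ 0`, so
`E det (H + v vᴴ) ≤ det (H + E v vᴴ)`. Averaging the independent columns of `A + ε G` one after the
other therefore gives `E |det (A + ε G)|² ≤ det (A Aᴴ + N ε²)`.

For `A = M - z` and `t = N ε² = N^{1 - 2γ}` the right-hand side is a product over the Jordan blocks.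
With `w = c_i - z` and `J` the corresponding block of size `d`, a recurrence in `d` shows that
`det (J Jᴴ + t) ≤ C R ^ d max (|w|^{2d}, t)` for every `R > 1` and all small `t`. Because
`r_i ^ {2 d_i} = t`, the maximum is `max (|w|, r_i) ^ {2 d_i}`, and the product of these maxima is
`exp (2 N U_μ(z))`. Markov's inequality finishes the proof: the loss `C ^ ℓ R ^ N` is beaten by
`exp (-2 N δ)`, as `ℓ = o(N)` and `R` can be taken close to `1`.
-/

open Matrix
open scoped ComplexOrder MatrixOrder

section Determinant

theorem one_add_sum_le_prod_one_add {ι R : Type*} [CommSemiring R] [PartialOrder R]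
    [IsOrderedRing R] (s : Finset ι) {f : ι → R} (hf : ∀ i ∈ s, 0 ≤ f i) :
    1 + ∑ i ∈ s, f i ≤ ∏ i ∈ s, (1 + f i) := by
  induction s using Finset.cons_induction with
  | empty => simp
  | cons a s ha ih =>
    rw [Finset.forall_mem_cons] at hf
    have hs : 0 ≤ ∑ i ∈ s, f i := Finset.sum_nonneg hf.2
    rw [Finset.sum_cons, Finset.prod_cons]
    calc 1 + (f a + ∑ i ∈ s, f i) ≤ 1 + (f a + ∑ i ∈ s, f i) + f a * ∑ i ∈ s, f i :=
          le_add_of_nonneg_right (mul_nonneg hf.1 hs)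
      _ = (1 + f a) * (1 + ∑ i ∈ s, f i) := by ring
      _ ≤ (1 + f a) * ∏ i ∈ s, (1 + f i) :=
          mul_le_mul_of_nonneg_left (ih hf.2) (add_nonneg zero_le_one hf.1)

variable {n 𝕜 : Type*} [Fintype n] [DecidableEq n] [RCLike 𝕜]

theorem det_one_add_eq_prod_eigenvalues {Q : Matrix n n 𝕜} (hQ : Q.IsHermitian) :
    (1 + Q).det = ∏ i, (1 + (hQ.eigenvalues i : 𝕜)) := by
  have h := Matrix.eval_charpoly Q (-1)
  rw [hQ.charpoly_eq, Polynomial.eval_prod, map_neg, map_one, ← neg_add', Matrix.det_neg] at h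
  have hsign : ((-1 : 𝕜) ^ Fintype.card n) * (-1) ^ Fintype.card n = 1 := by
    rw [← mul_pow, neg_one_mul, neg_neg, one_pow]
  calc (1 + Q).det = (-1) ^ Fintype.card n * ((-1) ^ Fintype.card n * (1 + Q).det) := by
        rw [← mul_assoc, hsign, one_mul]
    _ = (-1) ^ Fintype.card n * ∏ i, -(1 + (hQ.eigenvalues i : 𝕜)) := by
        rw [← h]; simp [← neg_add']
    _ = _ := by rw [Finset.prod_neg, ← mul_assoc, Finset.card_univ, hsign, one_mul]

theorem one_add_trace_le_det_one_add {Q : Matrix n n 𝕜} (hQ : Q.PosSemidef) :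
    1 + Q.trace ≤ (1 + Q).det := by
  rw [det_one_add_eq_prod_eigenvalues hQ.isHermitian, hQ.isHermitian.trace_eq_sum_eigenvalues]
  exact one_add_sum_le_prod_one_add _ fun i _ => by exact_mod_cast hQ.eigenvalues_nonneg i

theorem exists_posSemidef_det_add_eq {H P : Matrix n n 𝕜} (hH : H.PosDef)
    (hP : P.PosSemidef) : ∃ Q : Matrix n n 𝕜, Q.PosSemidef ∧ Q.trace = (H⁻¹ * P).trace ∧
      (H + P).det = H.det * (1 + Q).det := by
  set S := CFC.sqrt H
  have hSS : S * S = H := CFC.sqrt_mul_sqrt_self H hH.posSemidef.nonneg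
  have hSH : Sᴴ = S := (CFC.sqrt_nonneg H).posSemidef.isHermitian
  have hunit : IsUnit S.det := by
    refine isUnit_of_mul_isUnit_left (y := S.det) ?_
    rw [← det_mul, hSS]
    exact hH.det_pos.ne'.isUnit
  have hfactor : H + P = S * (1 + S⁻¹ * P * S⁻¹) * S := by
    rw [Matrix.mul_add, Matrix.add_mul, Matrix.mul_one, hSS, Matrix.mul_assoc S⁻¹,
      Matrix.mul_nonsing_inv_cancel_left _ _ hunit, Matrix.nonsing_inv_mul_cancel_right _ _ hunit]
  refine ⟨S⁻¹ * P * S⁻¹, ?_, ?_, ?_⟩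
  · simpa only [conjTranspose_nonsing_inv, hSH] using hP.mul_mul_conjTranspose_same S⁻¹
  · rw [← hSS, Matrix.mul_inv_rev, Matrix.trace_mul_comm, ← Matrix.mul_assoc,
      Matrix.trace_mul_comm, ← Matrix.mul_assoc]
  · rw [hfactor, det_mul, det_mul, ← hSS, det_mul]
    ring

theorem det_mul_one_add_trace_le_det_add {H P : Matrix n n 𝕜} (hH : H.PosDef)
    (hP : P.PosSemidef) : H.det * (1 + (H⁻¹ * P).trace) ≤ (H + P).det := by
  obtain ⟨Q, hQ, htrace, hdet⟩ := exists_posSemidef_det_add_eq hH hP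
  rw [← htrace, hdet]
  exact mul_le_mul_of_nonneg_left (one_add_trace_le_det_one_add hQ) hH.det_pos.le

theorem det_le_det_add {Q P : Matrix n n 𝕜} (hQ : Q.PosSemidef) (hP : P.PosSemidef) :
    Q.det ≤ (Q + P).det := by
  rcases eq_or_ne Q.det 0 with h0 | h0
  · exact h0 ▸ (hQ.add hP).det_nonneg
  obtain ⟨R, hR, -, hdet⟩ := exists_posSemidef_det_add_eq (hQ.posDef_iff_det_ne_zero.2 h0) hP
  rw [hdet]
  exact le_mul_of_one_le_right hQ.det_nonneg
    ((le_add_of_nonneg_right hR.trace_nonneg).trans (one_add_trace_le_det_one_add hR))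

theorem det_add_vecMulVec_star {H : Matrix n n 𝕜} (hH : IsUnit H.det) (v : n → 𝕜) :
    (H + vecMulVec v (star v)).det = H.det * (1 + (H⁻¹ * vecMulVec v (star v)).trace) := by
  rw [trace_mul_comm, vecMulVec_mul, trace_vecMulVec, dotProduct_comm,
    vecMulVec_eq Unit, det_add_replicateCol_mul_replicateRow hH, ← replicateRow_vecMul,
    det_unique (n := Unit)]
  rfl

end Determinant

section SecondMoment

variable {Ω n 𝕜 : Type*} [MeasurableSpace Ω] {P : Measure Ω} [RCLike 𝕜]

/-- The matrix `E[v vᴴ]` of second moments of a random vector `v`, without centring. -/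
noncomputable def secondMomentMatrix (P : Measure Ω) (v : Ω → n → 𝕜) : Matrix n n 𝕜 :=
  Matrix.of fun i j => ∫ ω, v ω i * star (v ω j) ∂P

theorem integrable_mul_star {f g : Ω → 𝕜} (hf : MemLp f 2 P) (hg : MemLp g 2 P) :
    Integrable (fun ω => f ω * star (g ω)) P :=
  hf.integrable_mul hg.star

theorem trace_mul_secondMomentMatrix [Fintype n] {v : Ω → n → 𝕜}
    (hv : ∀ i, MemLp (fun ω => v ω i) 2 P) (K : Matrix n n 𝕜) :
    (K * secondMomentMatrix P v).trace =
      ∫ ω, (K * vecMulVec (v ω) (star (v ω))).trace ∂P := by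
  have hint (i j : n) : Integrable (fun ω => K i j * (v ω j * star (v ω i))) P :=
    (integrable_mul_star (hv j) (hv i)).const_mul _
  simp only [Matrix.trace, diag_apply, mul_apply, vecMulVec_apply, Pi.star_apply,
    secondMomentMatrix, of_apply]
  rw [integral_finsetSum _ fun i _ => integrable_finsetSum _ fun j _ => hint i j]
  refine Finset.sum_congr rfl fun i _ => ?_
  rw [integral_finsetSum _ fun j _ => hint i j]
  exact Finset.sum_congr rfl fun j _ => (integral_const_mul _ _).symm

theorem integrable_trace_mul_vecMulVec_star [Fintype n] {v : Ω → n → 𝕜}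
    (hv : ∀ i, MemLp (fun ω => v ω i) 2 P) (K : Matrix n n 𝕜) :
    Integrable (fun ω => (K * vecMulVec (v ω) (star (v ω))).trace) P :=
  integrable_finsetSum _ fun i _ => integrable_finsetSum _ fun j _ =>
    (integrable_mul_star (hv j) (hv i)).const_mul _

theorem secondMomentMatrix_posSemidef [Finite n] {v : Ω → n → 𝕜}
    (hv : ∀ i, MemLp (fun ω => v ω i) 2 P) : (secondMomentMatrix P v).PosSemidef := by
  have := Fintype.ofFinite n
  refine PosSemidef.of_dotProduct_mulVec_nonneg ?_ fun x => ?_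
  · ext i j
    simp only [secondMomentMatrix, conjTranspose_apply, of_apply, RCLike.star_def]
    rw [← integral_conj]
    simp [mul_comm]
  · have htrace (M : Matrix n n 𝕜) : star x ⬝ᵥ M *ᵥ x = (vecMulVec x (star x) * M).trace := by
      rw [vecMulVec_mul, trace_vecMulVec, dotProduct_mulVec, dotProduct_comm]
    rw [htrace, trace_mul_secondMomentMatrix hv]
    refine integral_nonneg fun ω => ?_
    change 0 ≤ _
    rw [← htrace]
    exact (posSemidef_vecMulVec_self_star (v ω)).dotProduct_mulVec_nonneg x

theorem integral_det_add_vecMulVec_star_le [Fintype n] [DecidableEq n] [IsProbabilityMeasure P]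
    {H : Matrix n n 𝕜} (hH : H.PosDef) {v : Ω → n → 𝕜}
    (hv : ∀ i, MemLp (fun ω => v ω i) 2 P) :
    ∫ ω, (H + vecMulVec (v ω) (star (v ω))).det ∂P ≤ (H + secondMomentMatrix P v).det := by
  simp only [det_add_vecMulVec_star hH.det_pos.ne'.isUnit]
  rw [integral_const_mul, integral_add (integrable_const _)
    (integrable_trace_mul_vecMulVec_star hv _), integral_const, probReal_univ, one_smul,
    ← trace_mul_secondMomentMatrix hv]
  exact det_mul_one_add_trace_le_det_add hH (secondMomentMatrix_posSemidef hv)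

theorem enorm_le_enorm_of_nonneg_of_le {x y : 𝕜} (hx : 0 ≤ x) (hxy : x ≤ y) : ‖x‖ₑ ≤ ‖y‖ₑ := by
  rw [enorm_le_iff_norm_le, ← RCLike.ofReal_le_ofReal (K := 𝕜), RCLike.norm_of_nonneg' hx,
    RCLike.norm_of_nonneg' (hx.trans hxy)]
  exact hxy

theorem lintegral_enorm_eq_enorm_integral_of_nonneg {f : Ω → 𝕜} (hf : Integrable f P)
    (h0 : ∀ ω, 0 ≤ f ω) : ∫⁻ ω, ‖f ω‖ₑ ∂P = ‖∫ ω, f ω ∂P‖ₑ := by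
  rw [← ofReal_integral_norm_eq_lintegral_enorm hf, ← ofReal_norm]
  have h : ∫ ω, f ω ∂P = ((∫ ω, ‖f ω‖ ∂P : ℝ) : 𝕜) := by
    rw [← integral_ofReal]
    exact integral_congr_ae (ae_of_all _ fun ω => (RCLike.norm_of_nonneg' (h0 ω)).symm)
  rw [h, RCLike.norm_ofReal, abs_of_nonneg (integral_nonneg fun _ => norm_nonneg _)]

theorem lintegral_enorm_det_add_vecMulVec_star_le [Fintype n] [DecidableEq n]
    [IsProbabilityMeasure P] {H : Matrix n n 𝕜} (hH : H.PosDef) {v : Ω → n → 𝕜}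
    (hv : ∀ i, MemLp (fun ω => v ω i) 2 P) :
    ∫⁻ ω, ‖(H + vecMulVec (v ω) (star (v ω))).det‖ₑ ∂P ≤
      ‖(H + secondMomentMatrix P v).det‖ₑ := by
  have h0 (ω : Ω) : 0 ≤ (H + vecMulVec (v ω) (star (v ω))).det :=
    (hH.posSemidef.add (posSemidef_vecMulVec_self_star _)).det_nonneg
  have hint : Integrable (fun ω => (H + vecMulVec (v ω) (star (v ω))).det) P := by
    simp only [det_add_vecMulVec_star hH.det_pos.ne'.isUnit]
    exact ((integrable_const _).add (integrable_trace_mul_vecMulVec_star hv _)).const_mul _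
  rw [lintegral_enorm_eq_enorm_integral_of_nonneg hint h0]
  exact enorm_le_enorm_of_nonneg_of_le (integral_nonneg h0)
    (integral_det_add_vecMulVec_star_le hH hv)

theorem lmarginal_le_of_lintegral_update_le {ι : Type*} [DecidableEq ι] {α : ι → Type*}
    [∀ i, MeasurableSpace (α i)] {μ : ∀ i, Measure (α i)} [∀ i, SigmaFinite (μ i)]
    {F : Finset ι → (∀ i, α i) → ℝ≥0∞} (hF : Measurable (F ∅))
    (hstep : ∀ i s x, i ∉ s → ∫⁻ t, F s (Function.update x i t) ∂μ i ≤ F (insert i s) x)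
    (s : Finset ι) (x : ∀ i, α i) : (∫⋯∫⁻_s, F ∅ ∂μ) x ≤ F s x := by
  induction s using Finset.induction generalizing x with
  | empty => rw [lmarginal_empty]
  | insert i s hi ih =>
    rw [lmarginal_insert _ hF hi]
    exact (lintegral_mono fun t => ih _).trans (hstep i s x hi)

theorem lintegral_pi_enorm_det_add_sum_vecMulVec_star_le [Fintype n] [DecidableEq n]
    {κ : Type*} [Fintype κ] {H : Matrix n n 𝕜} (hH : H.PosDef) {μ : κ → Measure (n → 𝕜)}
    [∀ j, IsProbabilityMeasure (μ j)] (hμ : ∀ j i, MemLp (fun x => x i) 2 (μ j)) :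
    ∫⁻ x, ‖(H + ∑ j, vecMulVec (x j) (star (x j))).det‖ₑ ∂Measure.pi μ ≤
      ‖(H + ∑ j, secondMomentMatrix (μ j) id).det‖ₑ := by
  classical
  -- `R s x` is the Gram matrix in which the columns indexed by `s` have been averaged.
  let R (s : Finset κ) (x : κ → n → 𝕜) : Matrix n n 𝕜 :=
    H + ∑ j ∈ s, secondMomentMatrix (μ j) id + ∑ j ∈ sᶜ, vecMulVec (x j) (star (x j))
  have hmeas : Measurable fun x => ‖(R ∅ x).det‖ₑ :=
    Continuous.measurable <| Continuous.enorm <| Continuous.matrix_det <|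
      continuous_const.add <| continuous_finsetSum _ fun j _ =>
        Continuous.matrix_vecMulVec (by fun_prop) (by fun_prop)
  have hstep (j : κ) (s : Finset κ) (x : κ → n → 𝕜) (hj : j ∉ s) :
      ∫⁻ t, ‖(R s (Function.update x j t)).det‖ₑ ∂μ j ≤ ‖(R (insert j s) x).det‖ₑ := by
    let K := H + ∑ k ∈ s, secondMomentMatrix (μ k) id +
      ∑ k ∈ sᶜ.erase j, vecMulVec (x k) (star (x k))
    have hK : K.PosDef :=
      (hH.add_posSemidef (posSemidef_sum _ fun k _ => secondMomentMatrix_posSemidef (hμ k))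
        ).add_posSemidef (posSemidef_sum _ fun k _ => posSemidef_vecMulVec_self_star _)
    have hRs (t : n → 𝕜) : R s (Function.update x j t) = K + vecMulVec t (star t) := by
      have hsum : ∑ k ∈ sᶜ.erase j, vecMulVec (Function.update x j t k)
          (star (Function.update x j t k)) = ∑ k ∈ sᶜ.erase j, vecMulVec (x k) (star (x k)) :=
        Finset.sum_congr rfl fun k hk => by
          rw [Function.update_of_ne (Finset.ne_of_mem_erase hk)]
      simp only [R, K, ← Finset.sum_erase_add _ _ (Finset.mem_compl.2 hj), hsum,
        Function.update_self, add_assoc]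
    have hRj : R (insert j s) x = K + secondMomentMatrix (μ j) id := by
      simp only [R, K, Finset.sum_insert hj, Finset.compl_insert]
      abel
    simp only [hRs, hRj]
    exact lintegral_enorm_det_add_vecMulVec_star_le hK (hμ j)
  have hle := lmarginal_le_of_lintegral_update_le (F := fun s x => ‖(R s x).det‖ₑ) hmeas hstep
    Finset.univ 0
  rw [← lintegral_eq_lmarginal_univ] at hle
  simpa [R] using hle

theorem secondMomentMatrix_map_id {v : Ω → n → 𝕜} [Countable n] (hv : AEMeasurable v P) :
    secondMomentMatrix (P.map v) id = secondMomentMatrix P v := by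
  ext i j
  exact integral_map hv (by fun_prop)

theorem lintegral_enorm_det_add_sum_vecMulVec_star_le [Fintype n] [DecidableEq n]
    [IsProbabilityMeasure P] {κ : Type*} [Fintype κ] {H : Matrix n n 𝕜} (hH : H.PosDef)
    {v : κ → Ω → n → 𝕜} (hv : ∀ j i, MemLp (fun ω => v j ω i) 2 P) (hind : iIndepFun v P) :
    ∫⁻ ω, ‖(H + ∑ j, vecMulVec (v j ω) (star (v j ω))).det‖ₑ ∂P ≤
      ‖(H + ∑ j, secondMomentMatrix P (v j)).det‖ₑ := by
  have hmeas (j : κ) : AEMeasurable (v j) P :=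
    aemeasurable_pi_lambda _ fun i => (hv j i).aestronglyMeasurable.aemeasurable
  have hprob (j : κ) : IsProbabilityMeasure (P.map (v j)) :=
    Measure.isProbabilityMeasure_map (hmeas j)
  have hL2 (j : κ) (i : n) : MemLp (fun x : n → 𝕜 => x i) 2 (P.map (v j)) :=
    (memLp_map_measure_iff (measurable_pi_apply i).aestronglyMeasurable (hmeas j)).2 (hv j i)
  have hcont : Continuous fun x : κ → n → 𝕜 =>
      ‖(H + ∑ j, vecMulVec (x j) (star (x j))).det‖ₑ :=
    Continuous.enorm <| Continuous.matrix_det <|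
      continuous_const.add <| continuous_finsetSum _ fun j _ =>
        Continuous.matrix_vecMulVec (by fun_prop) (by fun_prop)
  have hle := lintegral_pi_enorm_det_add_sum_vecMulVec_star_le hH hL2
  rw [← hind.map_fun_eq_pi_map hmeas,
    lintegral_map' hcont.measurable.aemeasurable (aemeasurable_pi_lambda _ hmeas)] at hle
  simpa only [secondMomentMatrix_map_id (hmeas _)] using hle

end SecondMoment

section Noise

variable {Ω n κ 𝕜 : Type*} [MeasurableSpace Ω] {P : Measure Ω} [RCLike 𝕜]

/-- The columns of the random matrix `X` are independent, centred, and have the identity as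
covariance matrix: what the second moment method needs to know about the noise. The scalars are real
or complex, and in the complex case the covariance is `E[v vᴴ]`. -/
structure HasIsotropicColumns [DecidableEq n] (P : Measure Ω) (X : Ω → Matrix n κ 𝕜) : Prop where
  memLp : ∀ i j, MemLp (fun ω => X ω i j) 2 P
  integral_eq_zero : ∀ i j, ∫ ω, X ω i j ∂P = 0
  secondMomentMatrix_eq_one : ∀ j, secondMomentMatrix P (fun ω => (X ω).col j) = 1
  indep : iIndepFun (fun j ω => (X ω).col j) P

theorem mul_conjTranspose_eq_sum_vecMulVec [Fintype κ] (W : Matrix n κ 𝕜) :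
    W * Wᴴ = ∑ j, vecMulVec (W.col j) (star (W.col j)) := by
  ext i k
  simp [mul_apply, Matrix.sum_apply, vecMulVec_apply]

theorem secondMomentMatrix_add_smul [IsProbabilityMeasure P] {x : Ω → n → 𝕜}
    (hx : ∀ i, MemLp (fun ω => x ω i) 2 P) (h0 : ∀ i, ∫ ω, x ω i ∂P = 0) (a : n → 𝕜) (c : 𝕜) :
    secondMomentMatrix P (fun ω => a + c • x ω) =
      vecMulVec a (star a) + (c * star c) • secondMomentMatrix P x := by
  ext i j
  have hstar : ∫ ω, star (x ω j) ∂P = 0 := by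
    simp only [RCLike.star_def, integral_conj, h0, map_zero]
  have hexpand (ω : Ω) : (a + c • x ω) i * star ((a + c • x ω) j) =
      a i * star (a j) + a i * star c * star (x ω j) + c * star (a j) * x ω i +
        c * star c * (x ω i * star (x ω j)) := by
    simp only [Pi.add_apply, Pi.smul_apply, smul_eq_mul, star_add, star_mul']
    ring
  have h1 : Integrable (fun _ => a i * star (a j)) P := integrable_const _
  have h2 : Integrable (fun ω => a i * star c * star (x ω j)) P :=
    ((hx j).star.integrable one_le_two).const_mul _
  have h3 : Integrable (fun ω => c * star (a j) * x ω i) P :=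
    ((hx i).integrable one_le_two).const_mul _
  have h4 : Integrable (fun ω => c * star c * (x ω i * star (x ω j))) P :=
    (integrable_mul_star (hx i) (hx j)).const_mul _
  have h12 : Integrable (fun ω => a i * star (a j) + a i * star c * star (x ω j)) P := h1.add h2
  have h123 : Integrable (fun ω => a i * star (a j) + a i * star c * star (x ω j) +
      c * star (a j) * x ω i) P := h12.add h3
  simp only [secondMomentMatrix, of_apply, hexpand, Matrix.add_apply, Matrix.smul_apply,
    smul_eq_mul, vecMulVec_apply, Pi.star_apply]
  rw [integral_add h123 h4, integral_add h12 h3, integral_add h1 h2,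
    integral_const, probReal_univ, one_smul, integral_const_mul, integral_const_mul,
    integral_const_mul, hstar, h0]
  simp

variable [DecidableEq n]

theorem HasIsotropicColumns.lintegral_enorm_det_add_le [Fintype n] [Fintype κ]
    [IsProbabilityMeasure P] {X : Ω → Matrix n κ 𝕜} (hX : HasIsotropicColumns P X)
    {H : Matrix n n 𝕜} (hH : H.PosDef) (A : Matrix n κ 𝕜) (c : 𝕜) :
    ∫⁻ ω, ‖(H + (A + c • X ω) * (A + c • X ω)ᴴ).det‖ₑ ∂P ≤
      ‖(H + (A * Aᴴ + (Fintype.card κ * (c * star c)) • 1)).det‖ₑ := by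
  have hL2 (j : κ) (i : n) : MemLp (fun ω => (A.col j + c • (X ω).col j) i) 2 P := by
    simp only [Pi.add_apply, Pi.smul_apply, smul_eq_mul, col_apply]
    exact (memLp_const (A i j)).add ((hX.memLp i j).const_mul c)
  have hshift (j : κ) : Measurable fun x : n → 𝕜 => A.col j + c • x := by fun_prop
  have hind : iIndepFun (fun j ω => A.col j + c • (X ω).col j) P := hX.indep.comp _ hshift
  have hsum : ∑ j, secondMomentMatrix P (fun ω => A.col j + c • (X ω).col j) =
      A * Aᴴ + (Fintype.card κ * (c * star c)) • 1 := by
    have hcol (j : κ) : secondMomentMatrix P (fun ω => A.col j + c • (X ω).col j) =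
        vecMulVec (A.col j) (star (A.col j)) + (c * star c) • 1 := by
      rw [secondMomentMatrix_add_smul (x := fun ω => (X ω).col j) (hX.memLp · j)
        (hX.integral_eq_zero · j), hX.secondMomentMatrix_eq_one]
    rw [Finset.sum_congr rfl fun j _ => hcol j, Finset.sum_add_distrib,
      ← mul_conjTranspose_eq_sum_vecMulVec, Finset.sum_const, Finset.card_univ,
      ← Nat.cast_smul_eq_nsmul 𝕜, smul_smul]
  rw [← hsum]
  calc _ = ∫⁻ ω, ‖(H + ∑ j, vecMulVec (A.col j + c • (X ω).col j)
          (star (A.col j + c • (X ω).col j))).det‖ₑ ∂P :=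
        lintegral_congr fun ω => by rw [mul_conjTranspose_eq_sum_vecMulVec]; rfl
    _ ≤ _ := lintegral_enorm_det_add_sum_vecMulVec_star_le hH hL2 hind

theorem HasIsotropicColumns.lintegral_enorm_det_sq_le [Fintype n] [IsProbabilityMeasure P]
    {X : Ω → Matrix n n 𝕜} (hX : HasIsotropicColumns P X) (A : Matrix n n 𝕜) (c : 𝕜) :
    ∫⁻ ω, ‖(A + c • X ω).det‖ₑ ^ 2 ∂P ≤
      ‖(A * Aᴴ + (Fintype.card n * (c * star c)) • 1).det‖ₑ := by
  -- The bound for column averages needs a positive definite summand: add `s > 0`, let `s → 0`.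
  set K := A * Aᴴ + (Fintype.card n * (c * star c)) • (1 : Matrix n n 𝕜)
  have hbound {s : ℝ} (hs : 0 < s) :
      ∫⁻ ω, ‖(A + c • X ω).det‖ₑ ^ 2 ∂P ≤ ‖((s : 𝕜) • 1 + K).det‖ₑ := by
    have hH : ((s : 𝕜) • (1 : Matrix n n 𝕜)).PosDef := PosDef.one.smul (by exact_mod_cast hs)
    refine (lintegral_mono fun ω => ?_).trans (hX.lintegral_enorm_det_add_le hH A c)
    set W := A + c • X ω
    calc ‖W.det‖ₑ ^ 2 = ‖(W * Wᴴ).det‖ₑ := by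
          rw [det_mul, det_conjTranspose, enorm_mul, sq, RCLike.star_def, RCLike.enorm_conj]
      _ ≤ ‖((s : 𝕜) • 1 + W * Wᴴ).det‖ₑ := by
          rw [add_comm]
          exact enorm_le_enorm_of_nonneg_of_le (posSemidef_self_mul_conjTranspose W).det_nonneg
            (det_le_det_add (posSemidef_self_mul_conjTranspose W) hH.posSemidef)
  have hcont : Continuous fun s : ℝ => ‖((s : 𝕜) • 1 + K).det‖ₑ := by fun_prop
  have hlim : Tendsto (fun s : ℝ => ‖((s : 𝕜) • 1 + K).det‖ₑ) (𝓝[>] 0) (𝓝 ‖K.det‖ₑ) := by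
    simpa using (hcont.tendsto 0).mono_left nhdsWithin_le_nhds
  exact ge_of_tendsto hlim (eventually_mem_nhdsWithin.mono fun s hs => hbound hs)

end Noise

section Gaussian

variable {Ω : Type*} [MeasurableSpace Ω] {P : Measure Ω}

theorem iIndepFun_curry {ι κ E : Type*} [Countable ι] [Countable κ] [MeasurableSpace E]
    [IsProbabilityMeasure P] {X : ι × κ → Ω → E} (hX : ∀ p, AEMeasurable (X p) P)
    (hind : iIndepFun X P) : iIndepFun (fun i ω j => X (i, j) ω) P := by
  have hprob (i : ι) (j : κ) : IsProbabilityMeasure (P.map (X (i, j))) :=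
    Measure.isProbabilityMeasure_map (hX _)
  have hrow (i : ι) :
      P.map (fun ω j => X (i, j) ω) = Measure.infinitePi fun j => P.map (X (i, j)) :=
    (hind.precomp (Prod.mk_right_injective i)).map_fun_eq_infinitePi_map₀' fun j => hX (i, j)
  rw [iIndepFun_iff_map_fun_eq_infinitePi_map₀' fun i =>
    aemeasurable_pi_lambda _ fun j => hX (i, j)]
  simp only [hrow]
  rw [← Measure.infinitePi_map_curry fun i j => P.map (X (i, j)),
    ← hind.map_fun_eq_infinitePi_map₀' hX,
    AEMeasurable.map_map_of_aemeasurable (MeasurableEquiv.measurable _).aemeasurable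
      (aemeasurable_pi_lambda _ hX)]
  rfl

theorem integral_mul_self_gaussianReal : ∫ x, x * x ∂gaussianReal 0 1 = 1 := by
  have h := variance_id_gaussianReal (μ := 0) (v := 1)
  rw [variance_of_integral_eq_zero (by fun_prop) (by simp)] at h
  simpa [sq] using h

namespace IsStdGaussianMatrix

variable {N : ℕ} {G : Ω → Matrix (Fin N) (Fin N) ℝ}

theorem memLp (hG : IsStdGaussianMatrix P G) (i j : Fin N) : MemLp (fun ω => G ω i j) 2 P := by
  have h := memLp_id_gaussianReal (μ := 0) (v := 1) 2
  rw [← (hG.hasLaw i j).map_eq] at h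
  exact h.comp_of_map (hG.hasLaw i j).aemeasurable

theorem integral_eq_zero (hG : IsStdGaussianMatrix P G) (i j : Fin N) :
    ∫ ω, G ω i j ∂P = 0 :=
  (hG.hasLaw i j).integral_eq.trans integral_id_gaussianReal

theorem integral_mul_self (hG : IsStdGaussianMatrix P G) (i j : Fin N) :
    ∫ ω, G ω i j * G ω i j ∂P = 1 :=
  ((hG.hasLaw i j).integral_comp (f := fun x => x * x) (by fun_prop)).trans
    integral_mul_self_gaussianReal

theorem integral_mul_eq_zero (hG : IsStdGaussianMatrix P G) {i k : Fin N} (hik : i ≠ k)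
    (j : Fin N) : ∫ ω, G ω i j * G ω k j ∂P = 0 := by
  have hind : IndepFun (fun ω => G ω i j) (fun ω => G ω k j) P :=
    hG.indep.indepFun (i := (i, j)) (j := (k, j)) (by simpa using hik)
  rw [hind.integral_fun_mul_eq_mul_integral (hG.memLp i j).aestronglyMeasurable
    (hG.memLp k j).aestronglyMeasurable, hG.integral_eq_zero, zero_mul]

theorem hasIsotropicColumns [IsProbabilityMeasure P] (hG : IsStdGaussianMatrix P G) :
    HasIsotropicColumns P fun ω => (G ω).map Complex.ofReal where
  memLp i j := (hG.memLp i j).ofReal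
  integral_eq_zero i j := by
    rw [← Complex.ofReal_zero, ← hG.integral_eq_zero i j]
    exact integral_ofReal
  secondMomentMatrix_eq_one j := by
    ext i k
    have hcov : ∫ ω, G ω i j * G ω k j ∂P = if i = k then 1 else 0 := by
      split_ifs with hik
      · rw [hik, hG.integral_mul_self]
      · exact hG.integral_mul_eq_zero hik j
    simp only [secondMomentMatrix, of_apply, col_apply, map_apply, RCLike.star_def,
      Complex.conj_ofReal, ← Complex.ofReal_mul, one_apply]
    rw [integral_complex_ofReal, hcov]
    split_ifs <;> simp
  indep := by
    have hswap := iIndepFun_curry (fun p => (hG.memLp p.2 p.1).aestronglyMeasurable.aemeasurable)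
      (hG.indep.precomp Prod.swap_injective)
    exact hswap.comp (fun _ x i => (x i : ℂ)) fun _ => by fun_prop

end IsStdGaussianMatrix

end Gaussian

section Jordan

theorem det_of_tridiagonal_corner {R : Type*} [CommRing R] {d : ℕ}
    (M : Matrix (Fin (d + 2)) (Fin (d + 2)) R) (hrow : ∀ k : Fin d, M 0 k.succ.succ = 0)
    (hcol : ∀ k : Fin d, M k.succ.succ 0 = 0) :
    M.det = M 0 0 * (M.submatrix Fin.succ Fin.succ).det -
      M 0 1 * M 1 0 * (M.submatrix (Fin.succ ∘ Fin.succ) (Fin.succ ∘ Fin.succ)).det := by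
  have hminor : (M.submatrix Fin.succ (Fin.succAbove 1)).det =
      M 1 0 * (M.submatrix (Fin.succ ∘ Fin.succ) (Fin.succ ∘ Fin.succ)).det := by
    rw [det_succ_column_zero, Fin.sum_univ_succ]
    simp [hcol, submatrix_submatrix, Function.comp_def]
  rw [det_succ_row_zero, Fin.sum_univ_succ, Fin.sum_univ_succ]
  simp [hrow, hminor, Fin.succAbove_zero, mul_assoc, sub_eq_add_neg]

/-- The regularized Gram matrix `J Jᴴ + t` of the Jordan block `J` with eigenvalue `w`; its
determinant is the factor contributed by one block to the second moment bound. -/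
noncomputable def jordanGram (d : ℕ) (w : ℂ) (t : ℝ) : Matrix (Fin d) (Fin d) ℂ :=
  jordanBlock d w * (jordanBlock d w)ᴴ + (t : ℂ) • 1

theorem jordanBlock_succ_zero (d : ℕ) (w : ℂ) (i : Fin d) :
    jordanBlock (d + 1) w i.succ 0 = 0 := by
  simp [jordanBlock]

theorem jordanBlock_succ_succ (d : ℕ) (w : ℂ) (i j : Fin d) :
    jordanBlock (d + 1) w i.succ j.succ = jordanBlock d w i j := by
  simp [jordanBlock]

theorem jordanBlock_zero_mul_conjTranspose (d : ℕ) (w : ℂ) (i : Fin (d + 2)) :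
    (jordanBlock (d + 2) w * (jordanBlock (d + 2) w)ᴴ) 0 i =
      w * star (jordanBlock (d + 2) w i 0) + star (jordanBlock (d + 2) w i 1) := by
  simp [mul_apply, Fin.sum_univ_succ, jordanBlock, (Fin.succ_ne_zero _).symm]

theorem jordanGram_isHermitian (d : ℕ) (w : ℂ) (t : ℝ) : (jordanGram d w t).IsHermitian :=
  (isHermitian_mul_conjTranspose_self _).add (by simp [IsHermitian, conjTranspose_smul])

theorem jordanGram_submatrix_succ (d : ℕ) (w : ℂ) (t : ℝ) :
    (jordanGram (d + 1) w t).submatrix Fin.succ Fin.succ = jordanGram d w t := by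
  ext i j
  simp [jordanGram, jordanBlock_succ_zero, jordanBlock_succ_succ, mul_apply, Fin.sum_univ_succ,
    one_apply]

theorem jordanGram_zero_zero (d : ℕ) (w : ℂ) (t : ℝ) :
    jordanGram (d + 2) w t 0 0 = (‖w‖ ^ 2 + 1 + t : ℝ) := by
  rw [jordanGram, Matrix.add_apply, jordanBlock_zero_mul_conjTranspose]
  simp [jordanBlock, Complex.mul_conj']

theorem jordanGram_zero_one (d : ℕ) (w : ℂ) (t : ℝ) : jordanGram (d + 2) w t 0 1 = star w := by
  rw [jordanGram, Matrix.add_apply, jordanBlock_zero_mul_conjTranspose]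
  simp [jordanBlock]

theorem jordanGram_zero_succ_succ (d : ℕ) (w : ℂ) (t : ℝ) (k : Fin d) :
    jordanGram (d + 2) w t 0 k.succ.succ = 0 := by
  have h1 : jordanBlock (d + 2) w k.succ.succ 1 = 0 :=
    (jordanBlock_succ_succ _ w k.succ 0).trans (jordanBlock_succ_zero d w k)
  simp [jordanGram, jordanBlock_zero_mul_conjTranspose, jordanBlock_succ_zero, h1, one_apply,
    (Fin.succ_ne_zero _).symm]

theorem det_jordanGram_one (w : ℂ) (t : ℝ) : (jordanGram 1 w t).det = (‖w‖ ^ 2 + t : ℝ) := by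
  simp [jordanGram, jordanBlock, mul_apply, Complex.mul_conj']

theorem det_jordanGram_add_two (d : ℕ) (w : ℂ) (t : ℝ) :
    (jordanGram (d + 2) w t).det =
      (‖w‖ ^ 2 + 1 + t : ℝ) * (jordanGram (d + 1) w t).det -
        (‖w‖ ^ 2 : ℝ) * (jordanGram d w t).det := by
  have hH := jordanGram_isHermitian (d + 2) w t
  rw [det_of_tridiagonal_corner _ (jordanGram_zero_succ_succ d w t) fun k => by
      rw [← hH.apply, jordanGram_zero_succ_succ, star_zero],
    ← submatrix_submatrix, jordanGram_submatrix_succ, jordanGram_submatrix_succ,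
    jordanGram_zero_zero, ← hH.apply 1 0, jordanGram_zero_one, star_star, RCLike.star_def,
    Complex.conj_mul', Complex.ofReal_pow]

theorem det_jordanGram_succ (d : ℕ) (w : ℂ) (t : ℝ) :
    (jordanGram (d + 1) w t).det = (‖w‖ ^ 2 : ℝ) * (jordanGram d w t).det +
      t * ∑ k ∈ Finset.range (d + 1), (jordanGram k w t).det := by
  induction d with
  | zero => rw [det_jordanGram_one]; simp
  | succ d ih =>
    rw [det_jordanGram_add_two, Finset.sum_range_succ _ (d + 1), mul_add, ← sub_eq_of_eq_add' ih]
    push_cast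
    ring

theorem le_and_sum_le_of_recurrence {R s t m c₁ c₂ : ℝ} {u : ℕ → ℝ} (hR : 1 ≤ R) (hs : 0 ≤ s)
    (ht : 0 ≤ t) (hsm : s ≤ m) (hm : 1 ≤ m) (hc₁ : 0 ≤ c₁) (hc₂ : 1 ≤ c₂)
    (hRc₁ : c₁ + c₂ ≤ R * c₁) (hRc₂ : c₂ + 1 + (c₁ + c₂) * t ≤ R * c₂) (hu0 : u 0 ≤ 1)
    (hu : ∀ n, u (n + 1) ≤ s * u n + t * ∑ k ∈ Finset.range (n + 1), u k) (n : ℕ) :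
    u n ≤ R ^ n * (s ^ n + c₁ * t * m ^ n) ∧
      ∑ k ∈ Finset.range (n + 1), u k ≤ c₂ * R ^ n * m ^ n := by
  induction n with
  | zero => simpa using ⟨hu0.trans (by nlinarith [mul_nonneg hc₁ ht]), hu0.trans hc₂⟩
  | succ n ih =>
    have : 0 ≤ R ^ n := by positivity
    have hstep : u (n + 1) ≤ R ^ n * (s ^ (n + 1) + (c₁ + c₂) * t * m ^ (n + 1)) :=
      calc u (n + 1) ≤ s * u n + t * ∑ k ∈ Finset.range (n + 1), u k := hu n
        _ ≤ s * (R ^ n * (s ^ n + c₁ * t * m ^ n)) + t * (c₂ * R ^ n * m ^ n) := by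
          gcongr
          exacts [ih.1, ih.2]
        _ = R ^ n * (s ^ (n + 1) + c₁ * t * (m ^ n * s) + c₂ * t * (m ^ n * 1)) := by ring
        _ ≤ R ^ n * (s ^ (n + 1) + c₁ * t * (m ^ n * m) + c₂ * t * (m ^ n * m)) := by gcongr
        _ = R ^ n * (s ^ (n + 1) + (c₁ + c₂) * t * m ^ (n + 1)) := by ring
    constructor
    · calc u (n + 1) ≤ R ^ n * (1 * s ^ (n + 1) + (c₁ + c₂) * t * m ^ (n + 1)) := by
            rwa [one_mul]
        _ ≤ R ^ n * (R * s ^ (n + 1) + R * c₁ * t * m ^ (n + 1)) := by gcongr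
        _ = R ^ (n + 1) * (s ^ (n + 1) + c₁ * t * m ^ (n + 1)) := by ring
    · calc ∑ k ∈ Finset.range (n + 2), u k
          ≤ c₂ * R ^ n * (m ^ n * 1) + R ^ n * (s ^ (n + 1) + (c₁ + c₂) * t * m ^ (n + 1)) := by
            rw [Finset.sum_range_succ, mul_one]
            exact add_le_add ih.2 hstep
        _ ≤ c₂ * R ^ n * (m ^ n * m) + R ^ n * (m ^ (n + 1) + (c₁ + c₂) * t * m ^ (n + 1)) := by
            gcongr
        _ = (c₂ + 1 + (c₁ + c₂) * t) * (R ^ n * m ^ (n + 1)) := by ring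
        _ ≤ R * c₂ * (R ^ n * m ^ (n + 1)) := by gcongr
        _ = c₂ * R ^ (n + 1) * m ^ (n + 1) := by ring

theorem exists_le_mul_pow_mul_max_of_recurrence {R : ℝ} (hR : 1 < R) :
    ∃ C > 0, ∃ t₀ > 0, ∀ {s t : ℝ}, 0 ≤ s → 0 ≤ t → t ≤ t₀ → ∀ {u : ℕ → ℝ}, u 0 ≤ 1 →
      (∀ n, u (n + 1) ≤ s * u n + t * ∑ k ∈ Finset.range (n + 1), u k) →
      ∀ n, u n ≤ C * R ^ n * max (s ^ n) t := by
  have hR' : 0 < R - 1 := sub_pos.2 hR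
  set c₂ := 1 + 2 / (R - 1) with hc₂_def
  set c₁ := c₂ / (R - 1) with hc₁_def
  have hc₂ : 1 ≤ c₂ := le_add_of_nonneg_right (by positivity)
  have hc₁ : 0 < c₁ := by positivity
  have hRc₁ : R * c₁ = c₁ + c₂ := by rw [hc₁_def]; field_simp; ring
  have hRc₂ : c₂ + 2 ≤ R * c₂ := by
    have : (R - 1) * c₂ = R - 1 + 2 := by rw [hc₂_def]; field_simp
    linarith
  refine ⟨1 + c₁, by positivity, min 1 (1 / (c₁ + c₂)), by positivity, ?_⟩
  intro s t hs ht htle u hu0 hu n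
  have ht1 : t ≤ 1 := htle.trans (min_le_left _ _)
  have htc : (c₁ + c₂) * t ≤ 1 :=
    (le_div_iff₀' (by positivity)).1 (htle.trans (min_le_right _ _))
  have hbound := (le_and_sum_le_of_recurrence hR.le hs ht (le_max_right 1 s)
    (le_max_left 1 s) hc₁.le hc₂ hRc₁.ge (by linarith) hu0 hu n).1
  have hmax : t * max 1 s ^ n ≤ max (s ^ n) t := by
    rcases le_total s 1 with h | h
    · rw [max_eq_left h, one_pow, mul_one]
      exact le_max_right _ _
    · rw [max_eq_right h]
      exact (mul_le_of_le_one_left (by positivity) ht1).trans (le_max_left _ _)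
  calc u n ≤ R ^ n * (s ^ n + c₁ * (t * max 1 s ^ n)) := by rwa [← mul_assoc]
    _ ≤ R ^ n * (max (s ^ n) t + c₁ * max (s ^ n) t) := by
        gcongr
        exact le_max_left _ _
    _ = (1 + c₁) * R ^ n * max (s ^ n) t := by ring

theorem norm_det_jordanGram_succ_le (d : ℕ) (w : ℂ) {t : ℝ} (ht : 0 ≤ t) :
    ‖(jordanGram (d + 1) w t).det‖ ≤ ‖w‖ ^ 2 * ‖(jordanGram d w t).det‖ +
      t * ∑ k ∈ Finset.range (d + 1), ‖(jordanGram k w t).det‖ := by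
  rw [det_jordanGram_succ]
  refine (norm_add_le _ _).trans ?_
  rw [norm_mul, norm_mul, Complex.norm_of_nonneg (sq_nonneg _), Complex.norm_of_nonneg ht]
  gcongr
  exact norm_sum_le _ _

theorem det_blockDiagonal' {o R : Type*} [CommRing R] [Fintype o] [LinearOrder o]
    {m : o → Type*} [∀ i, Fintype (m i)] [∀ i, DecidableEq (m i)] (M : ∀ i, Matrix (m i) (m i) R) :
    (blockDiagonal' M).det = ∏ i, (M i).det := by
  rw [(blockTriangular_blockDiagonal' M).det_fintype]
  refine Finset.prod_congr rfl fun i _ => ?_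
  rw [← det_submatrix_equiv_self (Equiv.sigmaSubtype i).symm]
  congr 1
  ext k l
  exact blockDiagonal'_apply_eq M i k l

theorem jordanBlock_sub_smul_one (d : ℕ) (c z : ℂ) :
    jordanBlock d c - z • 1 = jordanBlock d (c - z) := by
  ext i j
  by_cases hij : i = j <;> simp [jordanBlock, hij]

theorem exists_norm_det_jordanGram_le {R : ℝ} (hR : 1 < R) :
    ∃ C > 0, ∃ t₀ > 0, ∀ {t : ℝ}, 0 ≤ t → t ≤ t₀ → ∀ (d : ℕ) (w : ℂ),
      ‖(jordanGram d w t).det‖ ≤ C * R ^ d * max ((‖w‖ ^ 2) ^ d) t := by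
  obtain ⟨C, hC, t₀, ht₀, hbound⟩ := exists_le_mul_pow_mul_max_of_recurrence hR
  exact ⟨C, hC, t₀, ht₀, fun ht htle d w => hbound (sq_nonneg _) ht htle
    (u := fun d => ‖(jordanGram d w _).det‖) (by simp)
    (fun d => norm_det_jordanGram_succ_le d w ht) d⟩

namespace JordanData

variable {N : ℕ} (B : JordanData N)

theorem matrix_sub_smul_one (z : ℂ) :
    B.matrix - z • 1 = (blockDiagonal' fun i => jordanBlock (B.dim i) (B.eig i - z)).submatrix
      B.index.symm B.index.symm := by
  simp only [← jordanBlock_sub_smul_one]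
  rw [← Pi.sub_def, blockDiagonal'_sub, ← Pi.smul_def, blockDiagonal'_smul, ← Pi.one_def,
    blockDiagonal'_one, ← submatrix_one_equiv B.index.symm]
  rfl

theorem det_gram_sub_smul_one (z : ℂ) (t : ℝ) :
    ((B.matrix - z • 1) * (B.matrix - z • 1)ᴴ + (t : ℂ) • 1).det =
      ∏ i, (jordanGram (B.dim i) (B.eig i - z) t).det := by
  simp only [jordanGram]
  rw [← det_blockDiagonal', ← Pi.add_def, blockDiagonal'_add, blockDiagonal'_mul,
    ← blockDiagonal'_conjTranspose, ← Pi.smul_def, blockDiagonal'_smul, ← Pi.one_def,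
    blockDiagonal'_one, matrix_sub_smul_one, conjTranspose_submatrix, submatrix_mul_equiv,
    ← submatrix_one_equiv B.index.symm, ← det_submatrix_equiv_self B.index.symm]
  rfl

theorem exists_norm_det_gram_sub_smul_one_le {R : ℝ} (hR : 1 < R) :
    ∃ C > 0, ∃ t₀ > 0, ∀ {t : ℝ}, 0 ≤ t → t ≤ t₀ → ∀ {N : ℕ} (B : JordanData N) (z : ℂ),
      ‖((B.matrix - z • 1) * (B.matrix - z • 1)ᴴ + (t : ℂ) • 1).det‖ ≤
        C ^ B.ℓ * R ^ N * ∏ i, max ((‖B.eig i - z‖ ^ 2) ^ B.dim i) t := by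
  obtain ⟨C, hC, t₀, ht₀, hbound⟩ := exists_norm_det_jordanGram_le hR
  refine ⟨C, hC, t₀, ht₀, fun {t} ht htle N B z => ?_⟩
  rw [det_gram_sub_smul_one, norm_prod]
  calc ∏ i, ‖(jordanGram (B.dim i) (B.eig i - z) t).det‖
      ≤ ∏ i, C * R ^ B.dim i * max ((‖B.eig i - z‖ ^ 2) ^ B.dim i) t :=
        Finset.prod_le_prod (fun i _ => norm_nonneg _) fun i _ => hbound ht htle _ _
    _ = _ := by
        rw [Finset.prod_mul_distrib, Finset.prod_mul_distrib, Finset.prod_const,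
          Finset.prod_pow_eq_pow_sum, B.sum_dim, Finset.card_univ, Fintype.card_fin]

end JordanData

end Jordan

section LogPotential

theorem ae_log_enorm_sub_eq {ρ : Measure ℂ} {z : ℂ} (h0 : ρ {z} = 0) :
    ∀ᵐ x ∂ρ, ENNReal.log ‖z - x‖ₑ = (Real.log ‖z - x‖ : EReal) := by
  have hne : ∀ᵐ x ∂ρ, x ≠ z := measure_eq_zero_iff_ae_notMem.1 h0
  filter_upwards [hne] with x hx
  rw [← ofReal_norm, ENNReal.log_ofReal_of_pos (norm_sub_pos_iff.2 hx.symm)]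

theorem logPotential_eq_integral {ρ : Measure ℂ} {z : ℂ} (h0 : ρ {z} = 0)
    (hint : Integrable (fun x => Real.log ‖z - x‖) ρ) :
    logPotential ρ z = ((∫ x, Real.log ‖z - x‖ ∂ρ : ℝ) : EReal) := by
  have hpos : ∫⁻ x, (ENNReal.log ‖z - x‖ₑ).toENNReal ∂ρ =
      ∫⁻ x, ENNReal.ofReal (Real.log ‖z - x‖) ∂ρ := by
    refine lintegral_congr_ae ((ae_log_enorm_sub_eq h0).mono fun x hx => ?_)
    simp only [hx, EReal.real_coe_toENNReal]
  have hneg : ∫⁻ x, (-ENNReal.log ‖z - x‖ₑ).toENNReal ∂ρ =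
      ∫⁻ x, ENNReal.ofReal (-Real.log ‖z - x‖) ∂ρ := by
    refine lintegral_congr_ae ((ae_log_enorm_sub_eq h0).mono fun x hx => ?_)
    simp only [hx, ← EReal.coe_neg, EReal.real_coe_toENNReal]
  rw [logPotential, hpos, hneg, integral_eq_lintegral_pos_part_sub_lintegral_neg_part hint,
    EReal.coe_sub, EReal.coe_ennreal_toReal, EReal.coe_ennreal_toReal]
  exacts [hint.neg.lintegral_lt_top.ne, hint.lintegral_lt_top.ne]

theorem logPotential_eq_bot {ρ : Measure ℂ} {z : ℂ} (h0 : ρ {z} ≠ 0) :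
    logPotential ρ z = ⊥ := by
  have hneg : ∫⁻ x, (-ENNReal.log ‖z - x‖ₑ).toENNReal ∂ρ = ⊤ := by
    refine top_unique (le_trans ?_ (setLIntegral_le_lintegral {z} _))
    simp [ENNReal.mul_top h0]
  rw [logPotential, hneg, EReal.coe_ennreal_top, EReal.sub_top]

section Atomic

variable {α : Type*} [MeasurableSpace α] [MeasurableSingletonClass α]

theorem sum_map_dirac_singleton [DecidableEq α] (s : Multiset α) (a : α) :
    (s.map Measure.dirac).sum {a} = s.count a := by
  induction s using Multiset.induction_on with
  | empty => simp
  | cons b s ih => simp [ih, Multiset.count_cons, Set.indicator_apply, eq_comm, add_comm]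

theorem integrable_sum_map_dirac (s : Multiset α) (f : α → ℝ) :
    Integrable f (s.map Measure.dirac).sum := by
  induction s using Multiset.induction_on with
  | empty => simp
  | cons a s ih =>
    rw [Multiset.map_cons, Multiset.sum_cons]
    exact (integrable_dirac (by simp)).add_measure ih

theorem integral_sum_map_dirac (s : Multiset α) (f : α → ℝ) :
    ∫ x, f x ∂(s.map Measure.dirac).sum = (s.map f).sum := by
  induction s using Multiset.induction_on with
  | empty => simp
  | cons a s ih =>
    rw [Multiset.map_cons, Multiset.sum_cons, integral_add_measure (integrable_dirac (by simp))
      (integrable_sum_map_dirac s f), ih, integral_dirac, Multiset.map_cons, Multiset.sum_cons]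

end Atomic

section EmpiricalMeasure

variable {N : ℕ} (A : Matrix (Fin N) (Fin N) ℂ) (z : ℂ)

theorem norm_det_sub_smul_one_eq_prod_roots {n K : Type*} [Fintype n] [DecidableEq n]
    [NormedField K] [IsAlgClosed K] (A : Matrix n n K) (z : K) :
    ‖(A - z • 1).det‖ = (A.charpoly.roots.map fun x => ‖z - x‖).prod := by
  rw [← neg_sub, det_neg, norm_mul, norm_pow, norm_neg, norm_one, one_pow, one_mul,
    smul_one_eq_diagonal, ← scalar_apply, ← eval_charpoly,
    (IsAlgClosed.splits A.charpoly).eval_eq_prod_roots_of_monic A.charpoly_monic]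
  exact (map_multiset_prod (normHom : K →*₀ ℝ) _).trans (by rw [Multiset.map_map]; rfl)

theorem empiricalSpectralMeasure_singleton_eq_zero_iff :
    empiricalSpectralMeasure A {z} = 0 ↔ (A - z • 1).det ≠ 0 := by
  rw [← norm_ne_zero_iff, norm_det_sub_smul_one_eq_prod_roots, empiricalSpectralMeasure,
    Measure.smul_apply, sum_map_dirac_singleton]
  simp only [smul_eq_mul, mul_eq_zero, ENNReal.inv_eq_zero, ENNReal.natCast_ne_top, false_or,
    Nat.cast_eq_zero, Multiset.count_eq_zero, ne_eq, Multiset.prod_eq_zero_iff, Multiset.mem_map,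
    norm_eq_zero, sub_eq_zero, exists_eq_right']

theorem logPotential_empiricalSpectralMeasure {A : Matrix (Fin N) (Fin N) ℂ} {z : ℂ} (hN : N ≠ 0)
    (hdet : (A - z • 1).det ≠ 0) :
    logPotential (empiricalSpectralMeasure A) z =
      ((Real.log ‖(A - z • 1).det‖ / N : ℝ) : EReal) := by
  have hpos : 0 < (A.charpoly.roots.map fun x => ‖z - x‖).prod := by
    rwa [← norm_det_sub_smul_one_eq_prod_roots, norm_pos_iff]
  rw [logPotential_eq_integral ((empiricalSpectralMeasure_singleton_eq_zero_iff A z).2 hdet),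
    empiricalSpectralMeasure, integral_smul_measure, integral_sum_map_dirac,
    norm_det_sub_smul_one_eq_prod_roots, Real.log_multiset_prod fun y hy => ?_, Multiset.map_map]
  · simp only [Function.comp_def, ENNReal.toReal_inv, ENNReal.toReal_natCast, smul_eq_mul,
      div_eq_inv_mul]
  · rintro rfl
    exact hpos.ne' (Multiset.prod_eq_zero hy)
  · exact (integrable_sum_map_dirac _ _).smul_measure (by simp [hN])

theorem ofReal_exp_le_enorm_det_sq_of_le_logPotential (hN : N ≠ 0) {u : ℝ}
    (hu : (u : EReal) ≤ logPotential (empiricalSpectralMeasure A) z) :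
    ENNReal.ofReal (Real.exp (2 * N * u)) ≤ ‖(A - z • 1).det‖ₑ ^ 2 := by
  by_cases hdet : (A - z • 1).det = 0
  · have hatom := (empiricalSpectralMeasure_singleton_eq_zero_iff A z).not_left.2 hdet
    rw [logPotential_eq_bot hatom] at hu
    exact absurd hu (by simp)
  · rw [logPotential_empiricalSpectralMeasure hN hdet, EReal.coe_le_coe_iff,
      le_div_iff₀' (by positivity), Real.le_log_iff_exp_le (norm_pos_iff.2 hdet)] at hu
    calc ENNReal.ofReal (Real.exp (2 * N * u)) = ENNReal.ofReal (Real.exp (N * u)) ^ 2 := by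
          rw [← ENNReal.ofReal_pow (Real.exp_nonneg _), ← Real.exp_nat_mul, mul_assoc,
            Nat.cast_ofNat]
      _ ≤ ‖(A - z • 1).det‖ₑ ^ 2 := by
          rw [← ofReal_norm]
          gcongr

end EmpiricalMeasure

section Circle

variable (c z : ℂ)

theorem uniformCircle_singleton {r : ℝ} (hr : r ≠ 0) : uniformCircle c r {z} = 0 := by
  have hc := (Set.countable_singleton z).preimage_circleMap c hr
  rw [uniformCircle, Measure.map_apply (by fun_prop) (measurableSet_singleton z),
    Measure.smul_apply, hc.measure_zero, smul_zero]

theorem integrable_uniformCircle {f : ℂ → ℝ} (hf : Measurable f) {r : ℝ}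
    (hint : CircleIntegrable f c r) : Integrable f (uniformCircle c r) := by
  rw [CircleIntegrable, intervalIntegrable_iff_integrableOn_Ioc_of_le Real.two_pi_pos.le] at hint
  rw [uniformCircle, integrable_map_measure hf.aestronglyMeasurable (by fun_prop)]
  exact hint.smul_measure (by simp [Real.pi_pos])

theorem integral_uniformCircle {f : ℂ → ℝ} (hf : Measurable f) (r : ℝ) :
    ∫ x, f x ∂uniformCircle c r = Real.circleAverage f c r := by
  rw [uniformCircle, integral_map (by fun_prop) hf.aestronglyMeasurable, integral_smul_measure,
    ENNReal.toReal_inv, ENNReal.toReal_ofReal Real.two_pi_pos.le, Real.circleAverage,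
    intervalIntegral.integral_of_le Real.two_pi_pos.le]

theorem measurable_log_norm_sub : Measurable fun x : ℂ => Real.log ‖z - x‖ :=
  Real.measurable_log.comp (by fun_prop)

theorem integrable_log_uniformCircle (r : ℝ) :
    Integrable (fun x => Real.log ‖z - x‖) (uniformCircle c r) := by
  refine integrable_uniformCircle c (measurable_log_norm_sub z) ?_
  simpa only [norm_sub_rev z] using circleIntegrable_log_norm_sub_const r

theorem integral_log_uniformCircle {r : ℝ} (hr : 0 < r) :
    ∫ x, Real.log ‖z - x‖ ∂uniformCircle c r = Real.log (max ‖c - z‖ r) := by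
  have h1 : 0 < max 1 (r⁻¹ * ‖c - z‖) := lt_max_of_lt_left one_pos
  rw [integral_uniformCircle c (measurable_log_norm_sub z)]
  simp only [norm_sub_rev z]
  rw [circleAverage_log_norm_sub_const_eq_log_radius_add_posLog hr.ne',
    Real.posLog_eq_log_max_one (by positivity), ← Real.log_mul hr.ne' h1.ne',
    mul_max_of_nonneg _ _ hr.le, mul_one, mul_inv_cancel_left₀ hr.ne', max_comm]

end Circle

namespace JordanData

variable {N : ℕ} (B : JordanData N) (γ : ℝ)

theorem radius_pos (i : Fin B.ℓ) : 0 < B.radius γ i :=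
  Real.exp_pos _

theorem logPotential_circleMeasure (hN : N ≠ 0) (z : ℂ) :
    logPotential (B.circleMeasure γ) z =
      ((∑ i, (B.dim i : ℝ) / N * Real.log (max ‖B.eig i - z‖ (B.radius γ i)) : ℝ) : EReal) := by
  have hw (i : Fin B.ℓ) : (B.dim i : ℝ≥0∞) / (N : ℝ≥0∞) ≠ ⊤ :=
    ENNReal.div_ne_top (by simp) (by exact_mod_cast hN)
  have hint (i : Fin B.ℓ) (_ : i ∈ Finset.univ) : Integrable (fun x => Real.log ‖z - x‖)
      (((B.dim i : ℝ≥0∞) / (N : ℝ≥0∞)) • uniformCircle (B.eig i) (B.radius γ i)) :=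
    (integrable_log_uniformCircle _ _ _).smul_measure (hw i)
  have h0 : B.circleMeasure γ {z} = 0 := by
    rw [circleMeasure, Measure.finsetSum_apply]
    refine Finset.sum_eq_zero fun i _ => ?_
    rw [Measure.smul_apply, uniformCircle_singleton _ _ (B.radius_pos γ i).ne', smul_zero]
  rw [logPotential_eq_integral h0 (integrable_finsetSum_measure.2 hint), circleMeasure,
    integral_finsetSum_measure hint]
  congr 1
  refine Finset.sum_congr rfl fun i _ => ?_
  rw [integral_smul_measure, integral_log_uniformCircle _ _ (B.radius_pos γ i)]
  simp

theorem radius_sq_pow (hN : 1 < N) (i : Fin B.ℓ) :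
    (B.radius γ i ^ 2) ^ B.dim i = (N : ℝ) ^ (1 - 2 * γ) := by
  have hlog : 0 < Real.log N := Real.log_pos (by exact_mod_cast hN)
  have hd : (0 : ℝ) < B.dim i := by exact_mod_cast B.dim_pos i
  rw [← pow_mul, radius, ← Real.exp_nat_mul, Real.rpow_def_of_pos (by positivity), a]
  congr 1
  push_cast
  field_simp
  ring

theorem exp_circlePotential (hN : 1 < N) (z : ℂ) :
    Real.exp (2 * N * ∑ i, (B.dim i : ℝ) / N * Real.log (max ‖B.eig i - z‖ (B.radius γ i))) =
      ∏ i, max ((‖B.eig i - z‖ ^ 2) ^ B.dim i) ((N : ℝ) ^ (1 - 2 * γ)) := by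
  rw [Finset.mul_sum, Real.exp_sum]
  refine Finset.prod_congr rfl fun i _ => ?_
  set m := max ‖B.eig i - z‖ (B.radius γ i)
  have hm : 0 < m := lt_max_of_lt_right (B.radius_pos γ i)
  have hmono : MonotoneOn (fun x : ℝ => (x ^ 2) ^ B.dim i) (Set.Ici 0) := fun x hx y _ hxy => by
    have : 0 ≤ x := hx
    dsimp only
    gcongr
  calc Real.exp (2 * N * (B.dim i / N * Real.log m))
      = Real.exp ((2 * B.dim i : ℕ) * Real.log m) := by
        congr 1
        push_cast
        field_simp
    _ = (m ^ 2) ^ B.dim i := by rw [Real.exp_nat_mul, Real.exp_log hm, pow_mul]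
    _ = _ := by
        rw [← B.radius_sq_pow γ hN i]
        exact hmono.map_max (norm_nonneg _) (B.radius_pos γ i).le

end JordanData

end LogPotential

section Concentration

variable {Ω : Type*} [MeasurableSpace Ω] {P : Measure Ω}

theorem HasIsotropicColumns.aemeasurable_det {n 𝕜 : Type*} [Fintype n] [DecidableEq n] [RCLike 𝕜]
    {X : Ω → Matrix n n 𝕜} (hX : HasIsotropicColumns P X) (A : Matrix n n 𝕜) (c : 𝕜) :
    AEMeasurable (fun ω => (A + c • X ω).det) P := by
  have hentry (i j : n) : AEMeasurable (fun ω => X ω i j) P :=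
    (hX.memLp i j).aestronglyMeasurable.aemeasurable
  simp only [det_apply, Matrix.add_apply, Matrix.smul_apply]
  fun_prop

theorem mul_rpow_neg_mul_self {x : ℝ} (hx : 0 < x) (γ : ℝ) :
    x * (x ^ (-γ) * x ^ (-γ)) = x ^ (1 - 2 * γ) := by
  nth_rw 1 [← Real.rpow_one x]
  rw [← Real.rpow_add hx, ← Real.rpow_add hx]
  congr 1
  ring

theorem JordanData.measure_logPotential_add_le [IsProbabilityMeasure P] {N : ℕ} (hN : 1 < N)
    (B : JordanData N) {γ : ℝ}
    {X : Ω → Matrix (Fin N) (Fin N) ℂ} (hX : HasIsotropicColumns P X) (z : ℂ) (δ : ℝ) {K : ℝ}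
    (hK : ‖((B.matrix - z • 1) * (B.matrix - z • 1)ᴴ +
      (((N : ℝ) ^ (1 - 2 * γ) : ℝ) : ℂ) • 1).det‖ ≤
        K * ∏ i, max ((‖B.eig i - z‖ ^ 2) ^ B.dim i) ((N : ℝ) ^ (1 - 2 * γ))) :
    P {ω | logPotential (B.circleMeasure γ) z + (δ : EReal) ≤ logPotential
      (empiricalSpectralMeasure (B.matrix + (((N : ℝ) ^ (-γ) : ℝ) : ℂ) • X ω)) z} ≤
      ENNReal.ofReal (K * Real.exp (-(2 * N * δ))) := by
  set ε : ℂ := (((N : ℝ) ^ (-γ) : ℝ) : ℂ) with hε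
  set A := B.matrix - z • 1
  set u := ∑ i, (B.dim i : ℝ) / N * Real.log (max ‖B.eig i - z‖ (B.radius γ i))
  set E := Real.exp (2 * N * (u + δ)) with hE
  have hε2 : (Fintype.card (Fin N) * (ε * star ε) : ℂ) = (((N : ℝ) ^ (1 - 2 * γ) : ℝ) : ℂ) := by
    have hN0 : (0 : ℝ) < N := by positivity
    rw [Fintype.card_fin, hε, RCLike.star_def, Complex.conj_ofReal, ← mul_rpow_neg_mul_self hN0]
    push_cast
    rfl
  have hsub : {ω | logPotential (B.circleMeasure γ) z + (δ : EReal) ≤ logPotential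
      (empiricalSpectralMeasure (B.matrix + ε • X ω)) z} ⊆
      {ω | ENNReal.ofReal E ≤ ‖(A + ε • X ω).det‖ₑ ^ 2} := fun ω hω => by
    rw [Set.mem_ofPred_eq, B.logPotential_circleMeasure γ (by positivity), ← EReal.coe_add] at hω
    rw [Set.mem_ofPred_eq, ← add_sub_right_comm]
    exact ofReal_exp_le_enorm_det_sq_of_le_logPotential _ z (by positivity) hω
  have hmoment : ∫⁻ ω, ‖(A + ε • X ω).det‖ₑ ^ 2 ∂P ≤
      ENNReal.ofReal (K * Real.exp (2 * N * u)) := by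
    refine (hX.lintegral_enorm_det_sq_le A ε).trans ?_
    rw [hε2, ← ofReal_norm, B.exp_circlePotential γ hN]
    exact ENNReal.ofReal_le_ofReal hK
  calc _ ≤ P {ω | ENNReal.ofReal E ≤ ‖(A + ε • X ω).det‖ₑ ^ 2} := measure_mono hsub
    _ ≤ (∫⁻ ω, ‖(A + ε • X ω).det‖ₑ ^ 2 ∂P) / ENNReal.ofReal E :=
        meas_ge_le_lintegral_div ((hX.aemeasurable_det A ε).enorm.pow_const 2)
          (by simp [hE, Real.exp_pos]) ENNReal.ofReal_ne_top
    _ ≤ ENNReal.ofReal (K * Real.exp (2 * N * u)) / ENNReal.ofReal E := by gcongr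
    _ = ENNReal.ofReal (K * Real.exp (-(2 * N * δ))) := by
        rw [← ENNReal.ofReal_div_of_pos (Real.exp_pos _), mul_div_assoc, ← Real.exp_sub]
        congr 3
        ring

theorem eventually_pow_le_exp_mul {ℓ : ℕ → ℕ}
    (hℓ : (fun N => (ℓ N : ℝ)) =o[atTop] fun N : ℕ => (N : ℝ)) {C : ℝ} (hC : 0 < C) {δ : ℝ}
    (hδ : 0 < δ) : ∀ᶠ N in atTop, C ^ ℓ N ≤ Real.exp (δ * N) := by
  filter_upwards [(hℓ.const_mul_left (Real.log C)).bound hδ] with N hN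
  rw [Real.norm_natCast] at hN
  rw [← Real.exp_log hC, ← Real.exp_nat_mul, Real.exp_le_exp, mul_comm]
  exact (Real.le_norm_self _).trans hN

theorem tendsto_ofReal_exp_neg_mul {δ : ℝ} (hδ : 0 < δ) :
    Tendsto (fun N : ℕ => ENNReal.ofReal (Real.exp (-(δ * N)))) atTop (𝓝 0) := by
  rw [← ENNReal.ofReal_zero]
  exact ENNReal.tendsto_ofReal (Real.tendsto_exp_neg_atTop_nhds_zero.comp
    (tendsto_natCast_atTop_atTop.const_mul_atTop hδ))

end Concentration

theorem proposition3p1_general (γ : ℝ) (hγ : 1 / 2 < γ) (B : ∀ N : ℕ, JordanData N)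
    (hℓ : (fun N : ℕ => ((B N).ℓ : ℝ)) =o[atTop] fun N : ℕ => (N : ℝ))
    {Ω : ℕ → Type*} [∀ N, MeasurableSpace (Ω N)] (P : ∀ N, Measure (Ω N))
    [∀ N, IsProbabilityMeasure (P N)]
    (X : ∀ N, Ω N → Matrix (Fin N) (Fin N) ℂ) (hX : ∀ N, HasIsotropicColumns (P N) (X N))
    (z : ℂ) (δ : ℝ) (hδ : 0 < δ) :
    Tendsto
      (fun N => P N {ω | logPotential ((B N).circleMeasure γ) z + (δ : EReal) ≤ logPotential
        (empiricalSpectralMeasure ((B N).matrix + (((N : ℝ) ^ (-γ) : ℝ) : ℂ) • X N ω)) z})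
      atTop (𝓝 0) := by
  obtain ⟨C, hC, t₀, ht₀, hdet⟩ :=
    JordanData.exists_norm_det_gram_sub_smul_one_le (Real.one_lt_exp_iff.2 hδ)
  have ht : Tendsto (fun N : ℕ => (N : ℝ) ^ (1 - 2 * γ)) atTop (𝓝 0) := by
    simpa only [neg_sub, Function.comp_def] using
      (tendsto_rpow_neg_atTop (y := 2 * γ - 1) (by linarith)).comp tendsto_natCast_atTop_atTop
  refine tendsto_of_tendsto_of_tendsto_of_le_of_le' tendsto_const_nhds
    (tendsto_ofReal_exp_neg_mul (half_pos hδ)) (Eventually.of_forall fun _ => zero_le) ?_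
  filter_upwards [eventually_pow_le_exp_mul hℓ hC (half_pos hδ), ht.eventually_le_const ht₀,
    eventually_gt_atTop 1] with N hCℓ htN hN
  refine ((B N).measure_logPotential_add_le hN (hX N) z δ (hdet (by positivity) htN (B N) z)).trans
    (ENNReal.ofReal_le_ofReal ?_)
  calc C ^ (B N).ℓ * Real.exp δ ^ N * Real.exp (-(2 * N * δ))
      ≤ Real.exp (δ / 2 * N) * Real.exp δ ^ N * Real.exp (-(2 * N * δ)) := by gcongr
    _ = Real.exp (-(δ / 2 * N)) := by
        rw [← Real.exp_nat_mul, ← Real.exp_add, ← Real.exp_add]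
        congr 1
        ring

theorem proposition3p1 (γ : ℝ) (hγ : 1 / 2 < γ) (B : ∀ N : ℕ, JordanData N)
    (hℓ : (fun N : ℕ => ((B N).ℓ : ℝ)) =o[atTop] fun N : ℕ => (N : ℝ))
    {Ω : ℕ → Type*} [∀ N, MeasurableSpace (Ω N)] (P : ∀ N, Measure (Ω N))
    [∀ N, IsProbabilityMeasure (P N)]
    (G : ∀ N, Ω N → Matrix (Fin N) (Fin N) ℝ) (hG : ∀ N, IsStdGaussianMatrix (P N) (G N))
    (z : ℂ) (δ : ℝ) (hδ : 0 < δ) :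
    Tendsto
      (fun N => P N {ω | logPotential ((B N).circleMeasure γ) z + (δ : EReal) ≤
        logPotential (empiricalSpectralMeasure ((B N).noisy γ (G N ω))) z})
      atTop (𝓝 0) :=
  proposition3p1_general γ hγ B hℓ P _ (fun N => (hG N).hasIsotropicColumns) z δ hδ
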